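/- Let $m\geq 1$ be an integer, let $\ell$ be an odd integer (of either sign), and set $\alpha=1+2^m\ell$ and $s=2^{m-1}$. In any group write $[x,y]=x^{-1}y^{-1}xy$ and $x^y=y^{-1}xy$. Let $$J=\langle A,B\mid A^{[A,B]}=A^\alpha,\ B^{[B,A]}=B^\alpha,\ A^{2^{3m-1}}=1,\ B^{2^{3m-1}}=1\rangle,\qquad C=[A,B],$$ let $Z_1(J)$ be the center of $J$, and for $n\in\mathbb{Z}$ put $\phi(n)=\frac{(n-1)n}{2}$. Then for all $i,j,k,a,b,c\in\mathbb{Z}$, $$[A^iB^jC^k,\,A^aB^bC^c]\equiv A^{e_A}B^{e_B}C^{e_C}\mod Z_1(J),$$ where \begin{align*} e_A&=2s\ell\{j\phi(a)-\phi(i)b+ic-ka\},\\ e_B&=2s\ell\{i\phi(b)-\phi(j)a+kb+j(ib-ab-c)\},\\ e_C&=ib-ja+2s\ell\{\phi(a)(\phi(j)+jb)-\phi(i)(\phi(b)+jb)+ijc-kab\}. \end{align*} -/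

import Mathlib

namespace MacdonaldJ

/-- The commutator in the convention `[x, y] = x⁻¹ y⁻¹ x y`
(Mathlib's `⁅x, y⁆` is `x * y * x⁻¹ * y⁻¹`). -/
def comm {T : Type*} [Group T] (x y : T) : T := x⁻¹ * y⁻¹ * x * y

/-- The right conjugate `x ^ y = y⁻¹ x y`. -/
def conjBy {T : Type*} [Group T] (x y : T) : T := y⁻¹ * x * y

/-- `φ(n) = (n - 1) n / 2`; the integer division is exact. -/
def phi (n : ℤ) : ℤ := (n - 1) * n / 2

/-- The relators of `J`, in the free group on `x = of 0` and `y = of 1`, where `α = 1 + 2 ^ m * ℓ`: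
`x ^ [x, y] = x ^ α`, `y ^ [y, x] = y ^ α`, `x ^ (2 ^ (3 m - 1)) = 1`, `y ^ (2 ^ (3 m - 1)) = 1`. -/
def relators (m : ℕ) (ℓ : ℤ) : Set (FreeGroup (Fin 2)) :=
  let x : FreeGroup (Fin 2) := FreeGroup.of 0
  let y : FreeGroup (Fin 2) := FreeGroup.of 1
  let α : ℤ := 1 + 2 ^ m * ℓ
  {conjBy x (comm x y) * (x ^ α)⁻¹,
   conjBy y (comm y x) * (y ^ α)⁻¹,
   x ^ (2 ^ (3 * m - 1)),
   y ^ (2 ^ (3 * m - 1))}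

/-- The group
`J = ⟨A, B | A ^ [A, B] = A ^ α, B ^ [B, A] = B ^ α, A ^ (2 ^ (3 m - 1)) = B ^ (2 ^ (3 m - 1)) = 1⟩`
with `α = 1 + 2 ^ m * ℓ`. -/
abbrev J (m : ℕ) (ℓ : ℤ) : Type := PresentedGroup (relators m ℓ)

/-- The generator `A` of `J`. -/
def A (m : ℕ) (ℓ : ℤ) : J m ℓ := PresentedGroup.of 0

/-- The generator `B` of `J`. -/
def B (m : ℕ) (ℓ : ℤ) : J m ℓ := PresentedGroup.of 1

/-- The element `C = [A, B]` of `J`. -/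
def C (m : ℕ) (ℓ : ℤ) : J m ℓ := comm (A m ℓ) (B m ℓ)

/-- The element `A ^ i * B ^ j * C ^ k` of `J`. -/
def word (m : ℕ) (ℓ i j k : ℤ) : J m ℓ := A m ℓ ^ i * B m ℓ ^ j * C m ℓ ^ k

end MacdonaldJ

namespace MacdonaldJ

/-! Put `u = 2^m ℓ = 2sℓ` and `N = 2^(2m-1)`. The proof rests on `A^N` and `B^N` being central
(`powers_mem_center`). Evaluating `B A^n` in two ways, with `n ≡ α` modulo `2^(3m-1)`, equates a
power of `A` with a power of `B` (`zpow_A_eq_zpow_B`). Both exponents are odd multiples of `N`, and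
odd numbers are invertible modulo the order bound `2^(3m-1)`, so `A^N` and `B^N` are powers of each
other and commute with both generators.

Modulo the center, exponents of `A`, `B` and hence `C` therefore live in `ZMod N`, where `u² = 0`.
Conjugation by `C` is then linear in `u`, and collection gives a closed formula for the product of
two words (`mul_words`). The commutator formula is checked from it in the form `xy = yx·w`
(`comm_words`). -/

theorem two_mul_phi (n : ℤ) : 2 * phi n = n * n - n := by
  have h : (2 : ℤ) ∣ (n - 1) * n := by
    have := Int.even_mul_pred_self n
    rw [mul_comm]
    exact this.two_dvd
  rw [phi, Int.mul_ediv_cancel' h]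
  ring

theorem phi_add (x y : ℤ) : phi (x + y) = phi x + phi y + x * y := by
  have h1 := two_mul_phi (x + y)
  have h2 := two_mul_phi x
  have h3 := two_mul_phi y
  linarith

theorem phi_zero : phi 0 = 0 := rfl

theorem phi_add_one (n : ℤ) : phi (n + 1) = phi n + n := by
  rw [phi_add, show phi 1 = 0 from rfl]
  ring

/-! ### Collection and commutators when `u² = 0` modulo `N` -/

section NormalForm

variable {T : Type*} [Group T] {N : ℕ} {u : ℤ} {A B C : T}

theorem zpow_congr {x : T} (hx : x ^ N = 1) {a b : ℤ} (h : (a : ZMod N) = b) : x ^ a = x ^ b := by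
  rw [ZMod.intCast_eq_intCast_iff_dvd_sub] at h
  obtain ⟨d, hd⟩ := h
  have : b = a + N * d := by linarith
  rw [this, zpow_add, zpow_mul, zpow_natCast, hx, one_zpow, mul_one]

theorem zpow_induction {x : T} {f : ℤ → T} (h0 : f 0 = 1) (hs : ∀ n, f n * x = f (n + 1)) (n : ℤ) :
    x ^ n = f n := by
  induction n using Int.induction_on with
  | zero => simp [h0]
  | succ n ih => rw [zpow_add_one, ih, hs]
  | pred n ih =>
    have := hs (-(n : ℤ) - 1)
    rw [sub_add_cancel] at this
    rw [zpow_sub_one, ih, ← this, mul_inv_cancel_right]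

/-- The relations that hold between the images of `A`, `B` and `C` modulo the center. -/
structure Relations (N : ℕ) (u : ℤ) (A B C : T) : Prop where
  sq : (u : ZMod N) * u = 0
  phi_mul : ∀ y : ℤ, (u : ZMod N) * (phi (u * y) : ℤ) = 0
  phi_self : (u : ZMod N) * (phi N : ℤ) = 0
  powA : A ^ N = 1
  powB : B ^ N = 1
  swap : B * A * C = A * B
  conjA : A * C = C * A ^ (1 + u)
  conjB : B * C = C * B ^ (1 - u)

namespace Relations

/-- Changing an argument of `phi` by a multiple of `u` is invisible after multiplication by `u`.
Since `phi` halves, `u² = 0` alone would not give this; hence the separate field `phi_mul`. -/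
theorem u_mul_phi (h : Relations N u A B C) (x y : ℤ) :
    (u : ZMod N) * (phi (x + u * y) : ℤ) = u * (phi x : ℤ) := by
  have h1 := h.sq
  have h2 := h.phi_mul y
  rw [phi_add]
  push_cast
  linear_combination h2 + (x : ZMod N) * y * h1

/-- As `v² = 0`, the inverse of `(1 + v)^k` is `1 - kv`. A general `v` serves `A` with `v = u` and
`B` with `v = -u`. -/
theorem conj_aux {x : T} (hx : x ^ N = 1) {v : ℤ} (hv : (v : ZMod N) * v = 0)
    (h : x * C = C * x ^ (1 + v)) (k a : ℤ) : C ^ k * x ^ a = x ^ (a - v * k * a) * C ^ k := by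
  have h1 (n : ℤ) : x ^ n * C = C * x ^ (n + v * n) := by
    have : SemiconjBy C (x ^ (1 + v)) x := h.symm
    have := (this.zpow_right n).eq
    rw [← this, ← zpow_mul]
    congr 2
    ring
  have h2 (n : ℤ) : C * x ^ n = x ^ (n - v * n) * C := by
    rw [h1]
    congr 1
    apply zpow_congr hx
    push_cast
    linear_combination (n : ZMod N) * hv
  have h3 (n : ℤ) : C⁻¹ * x ^ n = x ^ (n + v * n) * C⁻¹ := by
    rw [inv_mul_eq_iff_eq_mul, ← mul_assoc, eq_mul_inv_iff_mul_eq, h1]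
  induction k using Int.induction_on generalizing a with
  | zero => simp
  | succ k ih =>
    rw [zpow_add_one, mul_assoc, h2, ← mul_assoc, ih, mul_assoc]
    congr 1
    apply zpow_congr hx
    push_cast
    linear_combination (k : ZMod N) * a * hv
  | pred k ih =>
    rw [zpow_sub_one, mul_assoc, h3, ← mul_assoc, ih, mul_assoc]
    congr 1
    apply zpow_congr hx
    push_cast
    linear_combination (k : ZMod N) * a * hv

theorem zpow_C_mul_zpow_A (h : Relations N u A B C) (k a : ℤ) :
    C ^ k * A ^ a = A ^ (a - u * k * a) * C ^ k :=
  conj_aux h.powA h.sq h.conjA k a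

theorem zpow_C_mul_zpow_B (h : Relations N u A B C) (k b : ℤ) :
    C ^ k * B ^ b = B ^ (b + u * k * b) * C ^ k := by
  have := conj_aux (v := -u) h.powB (by push_cast; linear_combination h.sq)
    (by simpa [sub_eq_add_neg] using h.conjB) k b
  rw [this]
  congr 2
  ring

theorem AC_zpow (h : Relations N u A B C) (n : ℤ) :
    (A * C) ^ n = A ^ (n - u * phi n) * C ^ n := by
  refine zpow_induction (f := fun n => A ^ (n - u * phi n) * C ^ n) (by simp [phi_zero])
    (fun n => ?_) n
  have := h.zpow_C_mul_zpow_A n 1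
  rw [zpow_one] at this
  rw [zpow_add_one C, mul_assoc, ← mul_assoc (C ^ n), this, ← mul_assoc, ← mul_assoc, ← zpow_add,
    phi_add_one, mul_assoc]
  congr 2
  ring

/-- `A * C` is conjugate to `A`, so its `N`-th power is trivial; by `AC_zpow` that power is also `C
^ N`, because `u * phi N` vanishes. -/
theorem powC (h : Relations N u A B C) : C ^ N = 1 := by
  have h1 := h.AC_zpow N
  have h2 : SemiconjBy B (A * C) A := by
    rw [SemiconjBy, ← mul_assoc, h.swap]
  have h3 := (h2.zpow_right N).eq
  rw [zpow_natCast A, h.powA, one_mul] at h3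
  rw [mul_eq_left.mp h3] at h1
  have h4 : A ^ ((N : ℤ) - u * phi N) = A ^ (0 : ℤ) := by
    apply zpow_congr h.powA
    push_cast
    rw [h.phi_self]
    simp
  rw [h4] at h1
  simpa using h1.symm

theorem zpow_B_mul_A (h : Relations N u A B C) (j : ℤ) :
    B ^ j * A = A * (B ^ (j - u * phi j) * C ^ (-j)) := by
  have h1 : (B * C⁻¹) ^ j = B ^ (j - u * phi j) * C ^ (-j) := by
    refine zpow_induction (f := fun j => B ^ (j - u * phi j) * C ^ (-j)) (by simp [phi_zero])
      (fun n => ?_) j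
    have := h.zpow_C_mul_zpow_B (-n) 1
    rw [zpow_one] at this
    rw [mul_assoc, ← mul_assoc (C ^ (-n)), this, ← mul_assoc, ← mul_assoc, ← zpow_add,
      phi_add_one, mul_assoc, ← zpow_sub_one]
    congr 2 <;> ring
  have h2 : SemiconjBy A (B * C⁻¹) B := by
    rw [SemiconjBy, ← mul_assoc, mul_inv_eq_iff_eq_mul, h.swap]
  rw [← h1, (h2.zpow_right j).eq]

theorem zpow_C_mul_comm_A (h : Relations N u A B C) (k x : ℤ) :
    C ^ k * A ^ (u * x) = A ^ (u * x) * C ^ k := by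
  rw [h.zpow_C_mul_zpow_A]
  congr 1
  apply zpow_congr h.powA
  push_cast
  linear_combination -(k : ZMod N) * x * h.sq

theorem B_mul_zpow_A (h : Relations N u A B C) (x : ℤ) :
    B * A ^ (u * x) = A ^ (u * x) * (B * C ^ (-(u * x))) := by
  have h2 : SemiconjBy B (A * C) A := by
    rw [SemiconjBy, ← mul_assoc, h.swap]
  have h3 := (h2.zpow_right (u * x)).eq
  rw [h.AC_zpow] at h3
  have h4 : A ^ (u * x - u * phi (u * x)) = A ^ (u * x) := by
    apply zpow_congr h.powA
    push_cast
    rw [h.phi_mul, sub_zero]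
  rw [h4, ← mul_assoc, ← eq_mul_inv_iff_mul_eq, ← zpow_neg, mul_assoc] at h3
  exact h3

/-- Conjugation by `A ^ (u * x)` multiplies `B` by a power of `C` whose exponent is a multiple of
`u`, hence one commuting with `B`; no quadratic correction appears. -/
theorem zpow_B_mul_zpow_A_of_dvd (h : Relations N u A B C) (j x : ℤ) :
    B ^ j * A ^ (u * x) = A ^ (u * x) * (B ^ j * C ^ (-(u * x * j))) := by
  have h1 : (B * C ^ (-(u * x))) ^ j = B ^ j * C ^ (-(u * x * j)) := by
    have hc : Commute B (C ^ (-(u * x))) := by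
      have := h.zpow_C_mul_zpow_B (-(u * x)) 1
      have h4 : B ^ (1 + u * -(u * x) * 1) = B ^ (1 : ℤ) := by
        apply zpow_congr h.powB
        push_cast
        linear_combination -(x : ZMod N) * h.sq
      rw [h4, zpow_one] at this
      exact this.symm
    rw [hc.mul_zpow, ← zpow_mul]
    congr 2
    ring
  have h2 : SemiconjBy (A ^ (u * x)) (B * C ^ (-(u * x))) B := (h.B_mul_zpow_A x).symm
  rw [← h1, (h2.zpow_right j).eq]

theorem zpow_B_mul_zpow_A (h : Relations N u A B C) (j a : ℤ) :
    B ^ j * A ^ a = A ^ (a + u * j * phi a) * B ^ (j - u * phi j * a) *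
      C ^ (-(j * a) + u * phi a * phi j - u * j * j * phi a) := by
  have key := zpow_induction (x := A) (f := fun a => (B ^ j)⁻¹ * (A ^ (a + u * j * phi a) *
    B ^ (j - u * phi j * a) * C ^ (-(j * a) + u * phi a * phi j - u * j * j * phi a)))
    (by simp [phi_zero]) (fun n => ?_) a
  · rw [key, mul_inv_cancel_left]
  rw [mul_assoc]
  congr 1
  set p := n + u * j * phi n with hp
  set q := j - u * phi j * n with hq
  set r := -(j * n) + u * phi n * phi j - u * j * j * phi n with hr
  -- The surplus `A ^ (u * -r)` commutes with powers of `C` and passes powers of `B` at the cost of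
  -- a power of `C` only.
  have h1 : C ^ r * A = A * A ^ (u * -r) * C ^ r := by
    have := h.zpow_C_mul_zpow_A r 1
    rw [zpow_one] at this
    rw [this, ← zpow_one_add]
    congr 2
    ring
  have h2 := h.zpow_B_mul_A q
  have h3 := h.zpow_C_mul_comm_A (-q) (-r)
  have h4 := h.zpow_B_mul_zpow_A_of_dvd (q - u * phi q) (-r)
  have h5 : A ^ p * B ^ q * C ^ r * A = A ^ (p + 1 + u * -r) * B ^ (q - u * phi q) *
      C ^ (-(u * -r * (q - u * phi q)) + -q + r) := by
    calc A ^ p * B ^ q * C ^ r * A = A ^ p * (B ^ q * A) * A ^ (u * -r) * C ^ r := by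
          rw [mul_assoc _ (C ^ r), h1]; group
      _ = A ^ p * A * B ^ (q - u * phi q) * (C ^ (-q) * A ^ (u * -r)) * C ^ r := by
          rw [h2]; simp only [mul_assoc]
      _ = A ^ p * A * (B ^ (q - u * phi q) * A ^ (u * -r)) * C ^ (-q) * C ^ r := by
          rw [h3]; simp only [mul_assoc]
      _ = _ := by
          rw [h4]; simp only [zpow_add, zpow_one, mul_assoc]
  rw [h5]
  have e0 := h.sq
  have e1 : (u : ZMod N) * (phi q : ℤ) = u * (phi j : ℤ) := by
    have := h.u_mul_phi j (-(phi j * n))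
    rwa [show j + u * -(phi j * n) = q by rw [hq]; ring] at this
  have e2 : (2 : ZMod N) * (phi n : ℤ) = n * n - n := by exact_mod_cast congrArg _ (two_mul_phi n)
  have e3 : (2 : ZMod N) * (phi j : ℤ) = j * j - j := by exact_mod_cast congrArg _ (two_mul_phi j)
  congr 1
  · congr 1
    · apply zpow_congr h.powA
      rw [hp, hr, phi_add_one]
      push_cast
      grind
    · apply zpow_congr h.powB
      push_cast
      rw [e1, hq]
      push_cast
      ring
  · apply zpow_congr h.powC
    push_cast
    rw [e1, phi_add_one, hq, hr]
    push_cast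
    grind

theorem mul_words (h : Relations N u A B C) (i j k a b c : ℤ) :
    A ^ i * B ^ j * C ^ k * (A ^ a * B ^ b * C ^ c) =
      A ^ (i + a - u * k * a + u * j * phi a) *
      B ^ (j + b - u * phi j * a + u * k * b - u * j * a * b) *
      C ^ (k + c - j * a + u * k * j * a + u * phi a * phi j - u * j * j * phi a) := by
  have e0 := h.sq
  set a' := a - u * k * a with ha
  set b' := b + u * k * b with hb
  set r := -(j * a') + u * phi a' * phi j - u * j * j * phi a' with hr
  have e1 : (u : ZMod N) * (phi a' : ℤ) = u * (phi a : ℤ) := by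
    have := h.u_mul_phi a (-(k * a))
    rwa [show a + u * -(k * a) = a' by rw [ha]; ring] at this
  have h5 : A ^ i * B ^ j * C ^ k * (A ^ a * B ^ b * C ^ c) =
      A ^ (i + (a' + u * j * phi a')) * B ^ ((j - u * phi j * a') + (b' + u * r * b')) *
      C ^ (r + (k + c)) := by
    calc A ^ i * B ^ j * C ^ k * (A ^ a * B ^ b * C ^ c)
        = A ^ i * B ^ j * (C ^ k * A ^ a) * B ^ b * C ^ c := by simp only [mul_assoc]
      _ = A ^ i * B ^ j * A ^ a' * (C ^ k * B ^ b) * C ^ c := by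
          rw [h.zpow_C_mul_zpow_A, ← ha]; simp only [mul_assoc]
      _ = A ^ i * (B ^ j * A ^ a') * B ^ b' * C ^ k * C ^ c := by
          rw [h.zpow_C_mul_zpow_B, ← hb]; simp only [mul_assoc]
      _ = A ^ i * A ^ (a' + u * j * phi a') * B ^ (j - u * phi j * a') * (C ^ r * B ^ b')
            * C ^ k * C ^ c := by
          rw [h.zpow_B_mul_zpow_A, ← hr]; simp only [mul_assoc]
      _ = _ := by
          rw [h.zpow_C_mul_zpow_B]; simp only [zpow_add, mul_assoc]
  rw [h5]
  congr 1
  · congr 1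
    · apply zpow_congr h.powA
      push_cast
      rw [ha] at *
      push_cast at *
      grind
    · apply zpow_congr h.powB
      rw [hr, hb]
      push_cast
      rw [e1, ha]
      push_cast
      grind
  · apply zpow_congr h.powC
    rw [hr]
    push_cast
    have e2 : (a' : ZMod N) = a - u * k * a := by rw [ha]; push_cast; ring
    rw [e2]
    linear_combination ((phi j : ℤ) - j * j : ZMod N) * e1

theorem mul_word_of_dvd (h : Relations N u A B C) (i j k x y z : ℤ) :
    A ^ i * B ^ j * C ^ k * (A ^ (u * x) * B ^ (u * y) * C ^ z) =
      A ^ (i + u * x) * B ^ (j + u * y) * C ^ (k + z - j * (u * x)) := by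
  have e0 := h.sq
  have g1 := h.phi_mul x
  rw [h.mul_words]
  congr 1
  · congr 1
    · apply zpow_congr h.powA
      push_cast
      linear_combination (j : ZMod N) * g1 - (k : ZMod N) * x * e0
    · apply zpow_congr h.powB
      push_cast
      linear_combination (-((phi j : ℤ) : ZMod N) * x + k * y - u * j * x * y) * e0
  · apply zpow_congr h.powC
    push_cast
    linear_combination (((phi j : ℤ) : ZMod N) - j * j) * g1 + (k : ZMod N) * j * x * e0

theorem comm_words (h : Relations N u A B C) (i j k a b c : ℤ) :
    comm (A ^ i * B ^ j * C ^ k) (A ^ a * B ^ b * C ^ c) =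
      A ^ (u * (j * phi a - phi i * b + i * c - k * a)) *
      B ^ (u * (i * phi b - phi j * a + k * b + j * (i * b - a * b - c))) *
      C ^ (i * b - j * a + u * (phi a * (phi j + j * b) - phi i * (phi b + j * b)
        + i * j * c - k * a * b)) := by
  have e0 := h.sq
  set x := j * phi a - phi i * b + i * c - k * a with hx
  set y := i * phi b - phi j * a + k * b + j * (i * b - a * b - c) with hy
  set z := phi a * (phi j + j * b) - phi i * (phi b + j * b) + i * j * c - k * a * b with hz
  have g2 : (x : ZMod N) = j * (phi a : ℤ) - (phi i : ℤ) * b + i * c - k * a := by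
    rw [hx]; push_cast; ring
  have g3 : (y : ZMod N) = i * (phi b : ℤ) - (phi j : ℤ) * a + k * b + j * (i * b - a * b - c) := by
    rw [hy]; push_cast; ring
  have g4 : (z : ZMod N) = (phi a : ℤ) * ((phi j : ℤ) + j * b) - (phi i : ℤ) * ((phi b : ℤ) + j * b)
      + i * j * c - k * a * b := by
    rw [hz]; push_cast; ring
  clear_value x y z
  -- Writing `xy = yx·w` avoids inverting a word.
  suffices hw : A ^ i * B ^ j * C ^ k * (A ^ a * B ^ b * C ^ c) =
      A ^ a * B ^ b * C ^ c * (A ^ i * B ^ j * C ^ k) * (A ^ (u * x) * B ^ (u * y) *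
        C ^ (i * b - j * a + u * z)) by
    rw [comm, mul_assoc, mul_assoc, inv_mul_eq_iff_eq_mul, inv_mul_eq_iff_eq_mul, hw]
    simp only [mul_assoc]
  rw [h.mul_words, h.mul_words, h.mul_word_of_dvd]
  congr 1
  · congr 1
    · apply zpow_congr h.powA
      push_cast
      linear_combination -(u : ZMod N) * g2
    · apply zpow_congr h.powB
      push_cast
      linear_combination -(u : ZMod N) * g3
  · apply zpow_congr h.powC
    push_cast
    linear_combination ((b : ZMod N) + j) * u * g2 - (u : ZMod N) * g4 +
      (x : ZMod N) * (-(phi b : ℤ) * i + c * j - b * i * j) * e0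

end Relations

end NormalForm

/-! ### A relation between powers of `A` and `B` -/

section PowerRelation

variable {T : Type*} [Group T] {M n β : ℕ} {A B C : T}

theorem pow_mul_pow_of_mul_eq {x c : T} (h : c * x = x ^ β * c) (k : ℕ) :
    c ^ k * x = x ^ β ^ k * c ^ k := by
  induction k with
  | zero => simp
  | succ k ih =>
    have h1 : SemiconjBy c x (x ^ β) := h
    have h2 := (h1.pow_right (β ^ k)).eq
    rw [pow_succ', mul_assoc, ih, ← mul_assoc, h2, ← pow_mul, mul_assoc, ← pow_succ']

theorem mul_pow_eq_pow_geom_sum {x c : T} (h : c * x = x ^ β * c) (k : ℕ) :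
    (x * c) ^ k = x ^ (∑ i ∈ Finset.range k, β ^ i) * c ^ k := by
  induction k with
  | zero => simp
  | succ k ih =>
    rw [pow_succ, ih, Finset.sum_range_succ, pow_add, mul_assoc, ← mul_assoc (c ^ k),
      pow_mul_pow_of_mul_eq h, pow_succ c]
    simp only [mul_assoc]

theorem pow_eq_self_of_modEq {x : T} (hx : x ^ M = 1) {d : ℕ} (h : d ≡ 1 [MOD M]) : x ^ d = x := by
  have := pow_eq_pow_mod d hx
  rw [this, h, ← pow_eq_pow_mod 1 hx, pow_one]

/-- Compare `[A ^ n, B]` with `[A, B ^ n]`, using that conjugation by `C` sends `A` to `A ^ n`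
and `B ^ n` to `B`. -/
theorem zpow_A_eq_zpow_B (hA : A ^ M = 1) (hB : B ^ M = 1) (hn : n * β ≡ 1 [MOD M])
    (swap : B * A * C = A * B) (conjA : A * C = C * A ^ n) (conjB : C * B = B ^ n * C) :
    A ^ ((n : ℤ) - ∑ i ∈ Finset.range n, (β : ℤ) ^ i) =
      B ^ ((n : ℤ) ^ n * (β * (∑ i ∈ Finset.range n, (β : ℤ) ^ i) - 1)) := by
  have sA : SemiconjBy C (A ^ n) A := conjA.symm
  have sB : SemiconjBy C B (B ^ n) := conjB
  have cA : C * A = A ^ β * C := by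
    have := (sA.pow_right β).eq
    rwa [← pow_mul, pow_eq_self_of_modEq hA hn] at this
  have cB : SemiconjBy C (B ^ β) B := by
    have := sB.pow_right β
    rwa [← pow_mul, pow_eq_self_of_modEq hB hn] at this
  have cB' : C⁻¹ * B = B ^ β * C⁻¹ := (SemiconjBy.inv_symm_left_iff.mpr cB).eq
  obtain ⟨σ, hσ⟩ : ∃ σ, σ = ∑ i ∈ Finset.range n, β ^ i := ⟨_, rfl⟩
  have hσ' : ∑ i ∈ Finset.range n, (β : ℤ) ^ i = (σ : ℕ) := by rw [hσ]; push_cast; rfl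
  rw [hσ']
  have h1 : A ^ n * B = B * (A ^ σ * C ^ n) := by
    have : SemiconjBy B (A * C) A := by rw [SemiconjBy, ← mul_assoc, swap]
    rw [hσ, ← mul_pow_eq_pow_geom_sum cA, (this.pow_right n).eq]
  have h2 : B ^ n * A = A * (B ^ σ * C⁻¹ ^ n) := by
    have : SemiconjBy A (B * C⁻¹) B := by
      rw [SemiconjBy, ← mul_assoc, mul_inv_eq_iff_eq_mul, swap]
    rw [hσ, ← mul_pow_eq_pow_geom_sum cB', (this.pow_right n).eq]
  -- Conjugation by `C` carries `B` to `B ^ n` and `A ^ n` to `A`, so this is `h2` pulled back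
  -- through `C`.
  have h3 : B * A ^ n = A ^ n * (B ^ (β * σ) * C⁻¹ ^ n) := by
    apply mul_left_cancel (a := C)
    have t1 : SemiconjBy C (B * A ^ n) (B ^ n * A) := sB.mul_right sA
    have t2 : SemiconjBy C (B ^ (β * σ)) (B ^ σ) := by
      have := cB.pow_right σ
      rwa [← pow_mul] at this
    have t3 : SemiconjBy C (C⁻¹ ^ n) (C⁻¹ ^ n) := ((Commute.refl C).inv_right).pow_right n
    rw [t1.eq, h2, (sA.mul_right (t2.mul_right t3)).eq]
  -- Both sides equal `B⁻¹ (A ^ n)⁻¹ B A ^ n`, by `h3` and by `h1`. Conjugating by `C ^ n` then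
  -- separates `A` from `B`.
  have h4 : B⁻¹ * (B ^ (β * σ) * C⁻¹ ^ n) = (A ^ σ * C ^ n)⁻¹ * A ^ n := by
    have e1 : A ^ σ * C ^ n = B⁻¹ * (A ^ n * B) := by rw [h1, inv_mul_cancel_left]
    have e2 : B ^ (β * σ) * C⁻¹ ^ n = (A ^ n)⁻¹ * (B * A ^ n) := by rw [h3, inv_mul_cancel_left]
    rw [e1, e2]
    simp only [mul_inv_rev, inv_inv, mul_assoc]
  have h5 : SemiconjBy (C ^ n) B (B ^ n ^ n) := pow_mul_pow_of_mul_eq conjB n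
  have h6 := (h5.zpow_right (β * σ - 1)).eq
  rw [← zpow_natCast B (n ^ n), ← zpow_mul] at h6
  push_cast at h6
  rw [eq_comm, ← eq_mul_inv_iff_mul_eq] at h6
  rw [h6, mul_inv_rev, mul_assoc, eq_inv_mul_iff_mul_eq] at *
  rw [sub_eq_neg_add, sub_eq_neg_add, zpow_add, zpow_add, zpow_neg, zpow_neg, zpow_natCast,
    zpow_natCast, zpow_one, ← h4, inv_pow, ← Nat.cast_mul, zpow_natCast]
  simp only [mul_assoc]

end PowerRelation

/-! ### 2-adic valuation of the exponents -/

section Valuation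

theorem geom_sum_expansion (v : ℤ) (k : ℕ) :
    ∃ t : ℤ, ∑ i ∈ Finset.range k, (1 + v) ^ i = k + v * phi k + v ^ 2 * t := by
  have hp (k : ℕ) : ∃ t : ℤ, (1 + v) ^ k = 1 + k * v + v ^ 2 * t := by
    induction k with
    | zero => exact ⟨0, by simp⟩
    | succ k ih =>
      obtain ⟨t, ht⟩ := ih
      refine ⟨k + t + v * t, ?_⟩
      rw [pow_succ, ht]
      push_cast
      ring
  induction k with
  | zero => exact ⟨0, by simp [phi_zero]⟩
  | succ k ih =>
    obtain ⟨t, ht⟩ := ih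
    obtain ⟨r, hr⟩ := hp k
    refine ⟨t + r, ?_⟩
    rw [Finset.sum_range_succ, ht, hr]
    push_cast
    rw [phi_add_one]
    ring

/-- For `n = 1 + 2 ^ m * l` with `l` odd and `β` its inverse modulo `2 ^ (3 m - 1)`, both exponents
in `zpow_A_eq_zpow_B` are odd multiples of `2 ^ (2 m - 1)`; here `m = r + 1`. -/
theorem exponents_odd_multiples {r n β : ℕ} {l e : ℤ} (hl : Odd l)
    (hn : (n : ℤ) = 1 + 2 ^ (r + 1) * l) (hβ : (n : ℤ) * β = 1 + 2 ^ (3 * r + 2) * e) :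
    (∃ w : ℤ, Odd w ∧ (n : ℤ) - ∑ i ∈ Finset.range n, (β : ℤ) ^ i = 2 ^ (2 * r + 1) * w) ∧
    ∃ w : ℤ, Odd w ∧ (n : ℤ) ^ n * (β * (∑ i ∈ Finset.range n, (β : ℤ) ^ i) - 1) =
      2 ^ (2 * r + 1) * w := by
  have hno : Odd (n : ℤ) := by
    rw [hn, pow_succ']
    exact ⟨2 ^ r * l, by ring⟩
  have hβo : Odd (β : ℤ) := by
    have : Odd ((n : ℤ) * β) := ⟨2 ^ (3 * r + 1) * e, by rw [hβ]; ring⟩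
    exact (Int.odd_mul.mp this).2
  -- Chosen by solving `n * β = 1 + 2 ^ (3 * r + 2) * e` for `(β - 1) / 2 ^ (r + 1)`.
  obtain ⟨q, hq⟩ : ∃ q : ℤ, q = -(l * β) + 2 ^ (2 * r + 1) * e := ⟨_, rfl⟩
  have hqo : Odd q := by
    rw [hq]
    refine (hl.mul hβo).neg.add_even ⟨2 ^ (2 * r) * e, by ring⟩
  have hβq : (β : ℤ) = 1 + 2 ^ (r + 1) * q := by
    rw [hq]
    rw [hn] at hβ
    linear_combination hβ
  obtain ⟨t, ht⟩ := geom_sum_expansion (2 ^ (r + 1) * q) n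
  rw [← hβq] at ht
  -- Halving `n - 1` here is what makes the valuation `2 * r + 1` rather than `2 * r + 2`.
  have hphi : phi n = 2 ^ r * l * n := by
    have := two_mul_phi n
    have h2 : 2 * phi n = 2 * (2 ^ r * l * n) := by
      rw [this]
      linear_combination (n : ℤ) * hn
    linarith
  have h1 : (n : ℤ) - ∑ i ∈ Finset.range n, (β : ℤ) ^ i =
      2 ^ (2 * r + 1) * (-(q * l * n) + 2 * (-(q ^ 2 * t))) := by
    rw [ht, hphi]
    ring
  have ho : Odd (-(q * l * n) + 2 * (-(q ^ 2 * t))) :=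
    ((hqo.mul hl).mul hno).neg.add_even (even_two_mul _)
  refine ⟨⟨_, ho, h1⟩, (n : ℤ) ^ n * (-(β * (-(q * l * n) + 2 * (-(q ^ 2 * t)))) +
    2 * (2 ^ r * e)), (hno.pow).mul ((hβo.mul ho).neg.add_even (even_two_mul _)), ?_⟩
  linear_combination (n : ℤ) ^ n * (hβ - β * h1)

theorem mem_zpowers_of_odd {T : Type*} [Group T] {x : T} {k K : ℕ} (hx : x ^ 2 ^ K = 1) {w : ℤ}
    (hw : Odd w) : x ^ 2 ^ k ∈ Subgroup.zpowers (x ^ ((2 : ℤ) ^ k * w)) := by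
  have hc : IsCoprime w ((2 : ℤ) ^ K) := by
    apply IsCoprime.pow_right
    exact Int.isCoprime_iff_gcd_eq_one.mpr (Nat.coprime_two_right.mpr (Int.natAbs_odd.mpr hw))
  obtain ⟨d, e, hde⟩ := hc
  refine ⟨d, ?_⟩
  have : ((2 : ℤ) ^ k * w) * d = 2 ^ k + ((2 ^ K : ℕ) : ℤ) * (-e * 2 ^ k) := by
    push_cast
    linear_combination (2 : ℤ) ^ k * hde
  simp only
  rw [← zpow_mul, this, zpow_add, zpow_mul, zpow_natCast, hx, one_zpow, mul_one]
  exact_mod_cast zpow_natCast x (2 ^ k)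

end Valuation

/-! ### The group `J` and its quotient by the center -/

section Group

variable (m : ℕ) (ℓ : ℤ)

theorem relator_eq_one {r : FreeGroup (Fin 2)} (hr : r ∈ relators m ℓ) :
    FreeGroup.lift ![A m ℓ, B m ℓ] r = 1 := by
  have h1 : FreeGroup.lift ![A m ℓ, B m ℓ] = PresentedGroup.mk (relators m ℓ) := by
    ext i
    fin_cases i <;> simp [A, B, PresentedGroup.of]
  rw [h1]
  exact PresentedGroup.one_of_mem hr

theorem map_comm {T T' : Type*} [Group T] [Group T'] (f : T →* T') (x y : T) :
    f (comm x y) = comm (f x) (f y) := by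
  simp [comm]

theorem map_conjBy {T T' : Type*} [Group T] [Group T'] (f : T →* T') (x y : T) :
    f (conjBy x y) = conjBy (f x) (f y) := by
  simp [conjBy]

theorem A_mul_C : A m ℓ * C m ℓ = C m ℓ * A m ℓ ^ (1 + 2 ^ m * ℓ) := by
  have h := relator_eq_one m ℓ (Set.mem_insert _ _)
  simp only [map_mul, map_conjBy, map_comm, map_inv, map_zpow, FreeGroup.lift_apply_of] at h
  have h1 := mul_inv_eq_one.mp h
  rw [conjBy, mul_assoc, inv_mul_eq_iff_eq_mul] at h1
  exact h1

theorem C_mul_B : C m ℓ * B m ℓ = B m ℓ ^ (1 + 2 ^ m * ℓ) * C m ℓ := by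
  have h := relator_eq_one m ℓ (Set.mem_insert_of_mem _ (Set.mem_insert _ _))
  simp only [map_mul, map_conjBy, map_comm, map_inv, map_zpow, FreeGroup.lift_apply_of] at h
  have h1 := mul_inv_eq_one.mp h
  have h2 : comm (B m ℓ) (A m ℓ) = (C m ℓ)⁻¹ := by simp [C, comm, mul_assoc]
  rw [conjBy] at h1
  change (comm (B m ℓ) (A m ℓ))⁻¹ * B m ℓ * comm (B m ℓ) (A m ℓ) = _ at h1
  rw [h2, inv_inv, mul_inv_eq_iff_eq_mul] at h1
  exact h1

theorem A_pow : A m ℓ ^ 2 ^ (3 * m - 1) = 1 := by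
  have h := relator_eq_one m ℓ (Set.mem_insert_of_mem _ (Set.mem_insert_of_mem _
    (Set.mem_insert _ _)))
  simpa using h

theorem B_pow : B m ℓ ^ 2 ^ (3 * m - 1) = 1 := by
  have h := relator_eq_one m ℓ (Set.mem_insert_of_mem _ (Set.mem_insert_of_mem _
    (Set.mem_insert_of_mem _ (Set.mem_singleton _))))
  simpa using h

theorem B_mul_A_mul_C : B m ℓ * A m ℓ * C m ℓ = A m ℓ * B m ℓ := by
  simp [C, comm, mul_assoc]

theorem mem_center_of_commute {g : J m ℓ} (hA : Commute g (A m ℓ)) (hB : Commute g (B m ℓ)) :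
    g ∈ Subgroup.center (J m ℓ) := by
  have h : (⊤ : Subgroup (J m ℓ)) ≤ Subgroup.centralizer {g} := by
    rw [← PresentedGroup.closure_range_of (relators m ℓ), Subgroup.closure_le]
    rintro _ ⟨i, rfl⟩
    rw [SetLike.mem_coe, Subgroup.mem_centralizer_singleton_iff]
    fin_cases i
    · exact hA.eq.symm
    · exact hB.eq.symm
  rw [Subgroup.mem_center_iff]
  intro x
  exact Subgroup.mem_centralizer_singleton_iff.mp (h (Subgroup.mem_top x))

variable {m ℓ}

theorem powers_mem_center {r : ℕ} (hm : m = r + 1) (hℓ : Odd ℓ) :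
    A m ℓ ^ 2 ^ (2 * r + 1) ∈ Subgroup.center (J m ℓ) ∧
      B m ℓ ^ 2 ^ (2 * r + 1) ∈ Subgroup.center (J m ℓ) := by
  have hM : 3 * m - 1 = 3 * r + 2 := by omega
  have hA := A_pow m ℓ
  have hB := B_pow m ℓ
  have h1 := A_mul_C m ℓ
  have h2 := C_mul_B m ℓ
  rw [hM] at hA hB
  -- A natural representative of `α`, which may be negative; it still has the form `1 + 2 ^ m * l`
  -- with `l` odd.
  obtain ⟨n, hn⟩ : ∃ n : ℕ, (n : ℤ) = (1 + 2 ^ m * ℓ) % 2 ^ (3 * r + 2) :=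
    ⟨_, Int.toNat_of_nonneg (Int.emod_nonneg _ (by positivity))⟩
  obtain ⟨f, hf⟩ : ∃ f : ℤ, 1 + 2 ^ m * ℓ = n + 2 ^ (3 * r + 2) * f :=
    ⟨_, by rw [hn]; exact (Int.emod_add_mul_ediv _ _).symm⟩
  have key {x : J m ℓ} (hx : x ^ 2 ^ (3 * r + 2) = 1) : x ^ (1 + 2 ^ m * ℓ) = x ^ n := by
    have : ((2 : ℤ) ^ (3 * r + 2)) = ((2 ^ (3 * r + 2) : ℕ) : ℤ) := by push_cast; rfl
    rw [hf, zpow_add, zpow_mul, this, zpow_natCast, zpow_natCast, hx, one_zpow, mul_one]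
  rw [key hA] at h1
  rw [key hB] at h2
  have hn' : (n : ℤ) = 1 + 2 ^ (r + 1) * (ℓ - 2 ^ (2 * r + 1) * f) := by
    rw [hm] at hf
    linear_combination -hf
  have hl : Odd (ℓ - 2 ^ (2 * r + 1) * f) := hℓ.sub_even ⟨2 ^ (2 * r) * f, by ring⟩
  have hno : Odd n := by
    have : Odd (n : ℤ) := by
      rw [hn']
      exact ⟨2 ^ r * (ℓ - 2 ^ (2 * r + 1) * f), by ring⟩
    exact_mod_cast this
  obtain ⟨β, -, hβ⟩ := Nat.exists_mul_mod_eq_one_of_coprime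
    ((Nat.coprime_two_right.mpr hno).pow_right (3 * r + 2)) (Nat.one_lt_two_pow (by omega))
  have hβ' : n * β ≡ 1 [MOD 2 ^ (3 * r + 2)] := by
    rw [Nat.ModEq, hβ, Nat.mod_eq_of_lt (Nat.one_lt_two_pow (by omega))]
  obtain ⟨e, he⟩ : ∃ e : ℤ, (n : ℤ) * β = 1 + 2 ^ (3 * r + 2) * e := by
    obtain ⟨e, he⟩ := (Nat.modEq_iff_dvd.mp hβ'.symm)
    refine ⟨e, ?_⟩
    push_cast at he
    linarith
  have rel := zpow_A_eq_zpow_B hA hB hβ' (B_mul_A_mul_C m ℓ) h1 h2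
  obtain ⟨⟨v, hv, ev⟩, w, hw, ew⟩ := exponents_odd_multiples hl hn' he
  rw [ev, ew] at rel
  constructor
  · refine mem_center_of_commute m ℓ ((Commute.refl _).pow_left _) ?_
    have := mem_zpowers_of_odd (k := 2 * r + 1) hA hv
    rw [rel] at this
    obtain ⟨d, hd⟩ := this
    rw [← hd]
    exact ((Commute.refl _).zpow_left _).zpow_left _
  · refine mem_center_of_commute m ℓ ?_ ((Commute.refl _).pow_left _)
    have := mem_zpowers_of_odd (k := 2 * r + 1) hB hw
    rw [← rel] at this
    obtain ⟨d, hd⟩ := this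
    rw [← hd]
    exact ((Commute.refl _).zpow_left _).zpow_left _

/-- Here `u² = 2Nℓ²`; the spare factor 2 absorbs the halving in `phi (u * y)`. -/
theorem relations_mod_center {r : ℕ} (hm : m = r + 1) (hℓ : Odd ℓ) :
    Relations (2 ^ (2 * r + 1)) (2 * 2 ^ r * ℓ)
      (A m ℓ : J m ℓ ⧸ Subgroup.center (J m ℓ)) (B m ℓ : J m ℓ ⧸ Subgroup.center (J m ℓ))
      (C m ℓ : J m ℓ ⧸ Subgroup.center (J m ℓ)) := by
  obtain ⟨hA, hB⟩ := powers_mem_center hm hℓ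
  have hu : 1 + 2 ^ m * ℓ = 1 + 2 * 2 ^ r * ℓ := by rw [hm]; ring
  have hz {n d : ℤ} (h : n = 2 ^ (2 * r + 1) * d) : (n : ZMod (2 ^ (2 * r + 1))) = 0 := by
    rw [ZMod.intCast_zmod_eq_zero_iff_dvd]
    exact ⟨d, by push_cast; exact h⟩
  have sq : ((2 * 2 ^ r * ℓ : ℤ) : ZMod (2 ^ (2 * r + 1))) * (2 * 2 ^ r * ℓ : ℤ) = 0 := by
    rw [← Int.cast_mul]
    exact hz (d := 2 * ℓ ^ 2) (by ring)
  have powB : (B m ℓ : J m ℓ ⧸ Subgroup.center (J m ℓ)) ^ 2 ^ (2 * r + 1) = 1 := by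
    rw [← QuotientGroup.mk_pow]
    exact (QuotientGroup.eq_one_iff _).mpr hB
  refine ⟨sq, fun y => ?_, ?_, ?_, powB, ?_, ?_, ?_⟩
  · have h1 : phi (2 * 2 ^ r * ℓ * y) = 2 ^ r * ℓ * y * (2 * 2 ^ r * ℓ * y - 1) := by
      have := two_mul_phi (2 * 2 ^ r * ℓ * y)
      linarith
    rw [← Int.cast_mul, h1]
    exact hz (d := ℓ ^ 2 * y * (2 * 2 ^ r * ℓ * y - 1)) (by ring)
  · have h1 : phi ((2 ^ (2 * r + 1) : ℕ) : ℤ) = 2 ^ (2 * r) * (2 ^ (2 * r + 1) - 1) := by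
      have := two_mul_phi ((2 ^ (2 * r + 1) : ℕ) : ℤ)
      push_cast at this ⊢
      rw [pow_succ] at *
      linarith
    rw [← Int.cast_mul, h1]
    exact hz (d := 2 ^ r * ℓ * (2 ^ (2 * r + 1) - 1)) (by ring)
  · rw [← QuotientGroup.mk_pow]
    exact (QuotientGroup.eq_one_iff _).mpr hA
  · exact congrArg _ (B_mul_A_mul_C m ℓ)
  · have := A_mul_C m ℓ
    rw [hu] at this
    exact congrArg _ this
  · have h1 := C_mul_B m ℓ
    rw [hu] at h1
    have h2 : SemiconjBy (C m ℓ) (B m ℓ) (B m ℓ ^ (1 + 2 * 2 ^ r * ℓ)) := h1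
    -- The exponent `1 - u` inverts `1 + u` modulo `N`, which reverses the direction of the
    -- conjugation.
    have h3 := congrArg (QuotientGroup.mk (s := Subgroup.center (J m ℓ)))
      (h2.zpow_right (1 - 2 * 2 ^ r * ℓ)).eq
    rw [← zpow_mul] at h3
    simp only [QuotientGroup.mk_mul, QuotientGroup.mk_zpow] at h3
    rw [h3]
    congr 1
    rw [← zpow_one (B m ℓ : J m ℓ ⧸ Subgroup.center (J m ℓ)), ← zpow_mul]
    apply zpow_congr powB
    push_cast at sq ⊢
    linear_combination sq

end Group

end MacdonaldJ

theorem mainTheorem7 (m : ℕ) (hm : 1 ≤ m) (ℓ : ℤ) (hℓ : Odd ℓ)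
    (s : ℤ) (hs : s = 2 ^ (m - 1)) (i j k a b c : ℤ) :
    ((MacdonaldJ.comm (MacdonaldJ.word m ℓ i j k) (MacdonaldJ.word m ℓ a b c) :
        MacdonaldJ.J m ℓ) : MacdonaldJ.J m ℓ ⧸ Subgroup.center (MacdonaldJ.J m ℓ)) =
      ((MacdonaldJ.word m ℓ
          (2 * s * ℓ * (j * MacdonaldJ.phi a - MacdonaldJ.phi i * b + i * c - k * a))
          (2 * s * ℓ * (i * MacdonaldJ.phi b - MacdonaldJ.phi j * a + k * b
            + j * (i * b - a * b - c)))
          (i * b - j * a + 2 * s * ℓ * (MacdonaldJ.phi a * (MacdonaldJ.phi j + j * b)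
            - MacdonaldJ.phi i * (MacdonaldJ.phi b + j * b) + i * j * c - k * a * b)) :
        MacdonaldJ.J m ℓ) : MacdonaldJ.J m ℓ ⧸ Subgroup.center (MacdonaldJ.J m ℓ)) := by
  obtain ⟨r, rfl⟩ : ∃ r, m = r + 1 := ⟨m - 1, by omega⟩
  rw [Nat.add_sub_cancel] at hs
  subst hs
  have h := (MacdonaldJ.relations_mod_center (m := r + 1) (r := r) rfl hℓ).comm_words i j k a b c
  have hc := MacdonaldJ.map_comm (QuotientGroup.mk' (Subgroup.center (MacdonaldJ.J (r + 1) ℓ)))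
    (MacdonaldJ.word (r + 1) ℓ i j k) (MacdonaldJ.word (r + 1) ℓ a b c)
  exact hc.trans h
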